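/- Let $G$ be a connected Lie group with Lie algebra $\mathfrak g$, and let $a,b_1,\dots,b_k\in\mathfrak g$. Consider the left-invariant control-affine system $\dot q(t)=q(t)\bigl(a+\sum_{i=1}^k u_i(t)b_i\bigr)$, $q(0)=\mathrm{id}_G$, with piecewise constant controls $u=(u_1,\dots,u_k)$ with values in $\mathbb R^k$, and denote its solution at time $t$ by $q(u,t)$. The system is called small-time controllable on $G$ if for every $g\in G$ and every $T>0$ there exist $\tau\in[0,T]$ and a piecewise constant control $u:[0,\tau]\to\mathbb R^k$ with $q(u,\tau)=g$. Let $\mathfrak{sl}_2$ be the Lie algebra of traceless real $2\times2$ matrices, and let $\mathfrak h_d$ be the Heisenberg Lie algebra of real $(d+2)\times(d+2)$ matrices $$(x,y,z):=\begin{pmatrix}0&x&z\\0&0_d&y^{\top}\\0&0&0\end{pmatrix},\qquad x,y\in\mathbb R^d,\ z\in\mathbb R,$$ both with the commutator bracket. Let $\rho:\mathfrak{sl}_2\to\mathfrak{der}(\mathfrak h_d)$ be the homomorphism $$\rho\begin{pmatrix}\alpha&\beta\\\gamma&-\alpha\end{pmatrix}(x,y,z)=(\alpha x+\beta y,\ \gamma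 x-\alpha y,\ 0),$$ and let $\mathfrak{sl}_2\ltimes\mathfrak h_d$ be the Lie algebra $\mathfrak{sl}_2\oplus\mathfrak h_d$ with bracket $[(A,X),(B,Y)]=([A,B],[X,Y]+\rho(A)Y-\rho(B)X)$. Let $SL_2=SL_2(\mathbb R)$, let $H_d$ be the Heisenberg group of real unitriangular matrices $\exp(x,y,z)$, and let $SL_2\ltimes H_d$ be the associated Lie group, that is, the semidirect product in which $g=\begin{pmatrix}g_{11}&g_{12}\\g_{21}&g_{22}\end{pmatrix}\in SL_2$ acts on $H_d$ by the automorphism $\exp(x,y,z)\mapsto\exp(g_{11}x+g_{12}y,\ g_{21}x+g_{22}y,\ z)$. Let $\{a,b,c\}$ be a basis of $\mathfrak{sl}_2$ with $$[b,a]=c,\qquad [a,c]=2a,\qquad [b,c]=-2b,$$ and let $\{X_1,Y_1,\dots,X_d,Y_d,Z\}$ be a basis of $\mathfrak h_d$ with $[X_i,Y_i]=Z$ for $i=1,\dots,d$ and all other brackets of basis elements equal to zero. Elements of $\mathfrak{sl}_2$ and of $\mathfrak h_d$ are regarded as elements of $\mathfrak{sl}_2\ltimes\mathfrak h_d$. **Theorem.**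 (1) The system $$\dot q(t)=q(t)\Bigl(a+u_0(t)b+\sum_{i=1}^d u_i(t)X_i+r(t)Z\Bigr)$$ with real-valued piecewise constant controls $u_0,u_1,\dots,u_d,r$ is small-time controllable on $SL_2\ltimes H_d$. (2) The scalar-input system $\dot q(t)=q(t)\bigl(a+u_0(t)b\bigr)$ with real-valued piecewise constant control $u_0$ is small-time controllable on $SL_2$. -/

import Mathlib

noncomputable section

attribute [local instance 100] LieRing.ofAssociativeRing

/-! ### Left-invariant control-affine systems -/

namespace ControlAffine

/-- A control `u : ℝ → κ → ℝ` is piecewise constant on `[0, τ]`: outside a finite set of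
breakpoints it is constant on every subinterval of `[0, τ]`. -/
def IsPiecewiseConstant {κ : Type*} (u : ℝ → κ → ℝ) (τ : ℝ) : Prop :=
  ∃ F : Finset ℝ, ∀ s t : ℝ, 0 ≤ s → s ≤ t → t ≤ τ →
    Disjoint (Set.Icc s t) (F : Set ℝ) → u s = u t

variable {G : Type*} [Group G] {E : Type*} [AddCommGroup E] [Module ℝ E] [TopologicalSpace E]
  [IsTopologicalAddGroup E] [ContinuousSMul ℝ E]

/-- Let `G` be a Lie group that sits in the vector space `E` through the embedding `coord`, so that
the tangent space of `G` at the identity is a subspace of `E`. The curve `q` in `G` satisfies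
`q'(t) = q(t) ξ`, that is `q'(t) = d(L_{q(t)}) ξ` where `L` is left translation and `ξ` is a tangent
vector at the identity. The equation is carried back to the identity by the diffeomorphism
`L_{q(t)⁻¹}`: the curve `s ↦ q(t)⁻¹ q(s)`, which passes through the identity at `s = t`, has
velocity `ξ` there. -/
def HasLeftVelocityAt (coord : G → E) (q : ℝ → G) (ξ : E) (t : ℝ) : Prop :=
  HasDerivAt (fun s => coord ((q t)⁻¹ * q s)) ξ t

variable {𝔤 : Type*} [AddCommGroup 𝔤] [Module ℝ 𝔤] {κ : Type*} [Fintype κ]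

/-- `q` is the solution on `[0, τ]`, starting at the identity, of
`q'(t) = q(t) (a + ∑ i, u i (t) b i)` for the (piecewise constant) control `u`: a continuous curve
that satisfies the equation at all but finitely many times. The linear map `tangent` identifies
the Lie algebra `𝔤` of `G` with the tangent space of `G` at the identity, inside `E`. -/
def IsTrajectory (coord : G → E) (tangent : 𝔤 →ₗ[ℝ] E) (a : 𝔤) (b : κ → 𝔤)
    (u : ℝ → κ → ℝ) (τ : ℝ) (q : ℝ → G) : Prop :=
  q 0 = 1 ∧ ContinuousOn (fun t => coord (q t)) (Set.Icc 0 τ) ∧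
    ∃ F : Finset ℝ, ∀ t ∈ Set.Ioo 0 τ, t ∉ F →
      HasLeftVelocityAt coord q (tangent (a + ∑ i, u t i • b i)) t

/-- `g` is small-time reachable: for every `T > 0` it is reached from the identity in some time
`τ ∈ [0, T]` with a piecewise constant control. -/
def IsSmallTimeReachable (coord : G → E) (tangent : 𝔤 →ₗ[ℝ] E) (a : 𝔤) (b : κ → 𝔤)
    (g : G) : Prop :=
  ∀ T : ℝ, 0 < T → ∃ τ ∈ Set.Icc 0 T, ∃ u : ℝ → κ → ℝ, IsPiecewiseConstant u τ ∧
    ∃ q : ℝ → G, IsTrajectory coord tangent a b u τ q ∧ q τ = g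

/-- The system with drift `a` and control fields `b` is small-time controllable: every element of
the group is small-time reachable. -/
def IsSmallTimeControllable (coord : G → E) (tangent : 𝔤 →ₗ[ℝ] E) (a : 𝔤) (b : κ → 𝔤) : Prop :=
  ∀ g : G, IsSmallTimeReachable coord tangent a b g

end ControlAffine

/-! ### The group `SL₂(ℝ)` and its Lie algebra -/

/-- The group `SL₂(ℝ)`. -/
abbrev SL2 : Type := Matrix.SpecialLinearGroup (Fin 2) ℝ

/-- The Lie algebra `𝔰𝔩₂(ℝ)` of traceless matrices. -/
abbrev sl2 : Type := LieAlgebra.SpecialLinear.sl (Fin 2) ℝ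

namespace SL2

/-- The inclusion of `SL₂(ℝ)` in the space of `2 × 2` matrices. -/
def coord (g : SL2) : Matrix (Fin 2) (Fin 2) ℝ := g.1

/-- The tangent space of `SL₂(ℝ)` at the identity is the space of traceless matrices. -/
def tangent :
    sl2 →ₗ[ℝ] Matrix (Fin 2) (Fin 2) ℝ :=
  (LieAlgebra.SpecialLinear.sl (Fin 2) ℝ).toSubmodule.subtype

open scoped Matrix.Norms.Elementwise in
/-- On `SL₂(ℝ)`, the equation `q' = q ξ` is the matrix differential equation. -/
theorem hasLeftVelocityAt_iff (q : ℝ → SL2) (ξ : Matrix (Fin 2) (Fin 2) ℝ) (t : ℝ) :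
    ControlAffine.HasLeftVelocityAt coord q ξ t ↔
      HasDerivAt (fun s => (q s).1) ((q t).1 * ξ) t := by
  have key : ∀ (P : Matrix (Fin 2) (Fin 2) ℝ) {f : ℝ → Matrix (Fin 2) (Fin 2) ℝ}
      {f' : Matrix (Fin 2) (Fin 2) ℝ}, HasDerivAt f f' t →
      HasDerivAt (fun s => P * f s) (P * f') t := fun P f f' hf =>
    (LinearMap.toContinuousLinearMap (LinearMap.mulLeft ℝ P)).hasFDerivAt.comp_hasDerivAt t hf
  have hinv : ((q t)⁻¹).1 * (q t).1 = 1 := congrArg Subtype.val (inv_mul_cancel (q t))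
  have hinv' : (q t).1 * ((q t)⁻¹).1 = 1 := congrArg Subtype.val (mul_inv_cancel (q t))
  constructor
  · intro h
    have h2 := key (q t).1 h
    have : (fun s => (q t).1 * coord ((q t)⁻¹ * q s)) = fun s => (q s).1 := by
      funext s
      change (q t).1 * (((q t)⁻¹).1 * (q s).1) = _
      rw [← mul_assoc, hinv', one_mul]
    rwa [this] at h2
  · intro h
    have h2 := key ((q t)⁻¹).1 h
    rwa [← mul_assoc, hinv, one_mul] at h2

end SL2

/-- `{a, b, c}` is a basis of `𝔰𝔩₂(ℝ)` with `[b, a] = c`, `[a, c] = 2 a`, `[b, c] = -2 b`. -/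
structure IsSl2Basis (a b c : sl2) : Prop where
  linearIndependent : LinearIndependent ℝ ![a, b, c]
  span_eq_top : Submodule.span ℝ (Set.range ![a, b, c]) = ⊤
  lie_b_a : ⁅b, a⁆ = c
  lie_a_c : ⁅a, c⁆ = (2 : ℝ) • a
  lie_b_c : ⁅b, c⁆ = (-2 : ℝ) • b

/-! ### The Heisenberg Lie algebra -/

/-- Row and column indices of the matrices of size `d + 2 = 1 + d + 1`. -/
abbrev HIdx (d : ℕ) : Type := Unit ⊕ Fin d ⊕ Unit

/-- The matrix with rows `(0, x, z)`, `(0, 0_d, yᵀ)`, `(0, 0, 0)`. -/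
def heisMat {d : ℕ} (x y : Fin d → ℝ) (z : ℝ) : Matrix (HIdx d) (HIdx d) ℝ :=
  Matrix.of fun i j =>
    match i, j with
    | .inl _, .inr (.inl k) => x k
    | .inl _, .inr (.inr _) => z
    | .inr (.inl k), .inr (.inr _) => y k
    | _, _ => 0

theorem heisMat_add {d : ℕ} (x y x' y' : Fin d → ℝ) (z z' : ℝ) :
    heisMat x y z + heisMat x' y' z' = heisMat (x + x') (y + y') (z + z') := by
  ext i j
  rcases i with i | i | i <;> rcases j with j | j | j <;> simp [heisMat]

theorem heisMat_smul {d : ℕ} (r : ℝ) (x y : Fin d → ℝ) (z : ℝ) :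
    r • heisMat x y z = heisMat (r • x) (r • y) (r * z) := by
  ext i j
  rcases i with i | i | i <;> rcases j with j | j | j <;> simp [heisMat]

theorem heisMat_mul {d : ℕ} (x y x' y' : Fin d → ℝ) (z z' : ℝ) :
    heisMat x y z * heisMat x' y' z' = heisMat 0 0 (x ⬝ᵥ y') := by
  ext i j
  rcases i with i | i | i <;> rcases j with j | j | j <;>
    simp [heisMat, Matrix.mul_apply, dotProduct]

theorem heisMat_lie {d : ℕ} (x y x' y' : Fin d → ℝ) (z z' : ℝ) :
    ⁅heisMat x y z, heisMat x' y' z'⁆ = heisMat 0 0 (x ⬝ᵥ y' - x' ⬝ᵥ y) := by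
  rw [Ring.lie_def, heisMat_mul, heisMat_mul, sub_eq_iff_eq_add, heisMat_add]
  simp

/-- The Heisenberg Lie algebra `𝔥_d`, with the commutator of matrices as its bracket. -/
def heisenbergAlgebra (d : ℕ) : LieSubalgebra ℝ (Matrix (HIdx d) (HIdx d) ℝ) where
  carrier := {M | ∃ x y z, M = heisMat x y z}
  add_mem' := by
    rintro _ _ ⟨x, y, z, rfl⟩ ⟨x', y', z', rfl⟩
    exact ⟨_, _, _, heisMat_add ..⟩
  zero_mem' := ⟨0, 0, 0, by
    ext i j; rcases i with i | i | i <;> rcases j with j | j | j <;> simp [heisMat]⟩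
  smul_mem' := by
    rintro r _ ⟨x, y, z, rfl⟩
    exact ⟨_, _, _, heisMat_smul ..⟩
  lie_mem' := by
    rintro _ _ ⟨x, y, z, rfl⟩ ⟨x', y', z', rfl⟩
    exact ⟨_, _, _, heisMat_lie ..⟩

/-- The elements of `𝔥_d`. -/
abbrev heis (d : ℕ) : Type := heisenbergAlgebra d

namespace heis

variable {d : ℕ}

/-- The element of `𝔥_d` with coordinates `x`, `y`, `z`. -/
def mk (x y : Fin d → ℝ) (z : ℝ) : heis d := ⟨heisMat x y z, x, y, z, rfl⟩

/-- The row vector `x` of an element of `𝔥_d`. -/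
def x (X : heis d) : Fin d → ℝ := fun k => X.1 (.inl ()) (.inr (.inl k))

/-- The column vector `y` of an element of `𝔥_d`. -/
def y (X : heis d) : Fin d → ℝ := fun k => X.1 (.inr (.inl k)) (.inr (.inr ()))

/-- The corner entry `z` of an element of `𝔥_d`. -/
def z (X : heis d) : ℝ := X.1 (.inl ()) (.inr (.inr ()))

@[simp] theorem x_mk (x y : Fin d → ℝ) (z : ℝ) : (mk x y z).x = x := rfl
@[simp] theorem y_mk (x y : Fin d → ℝ) (z : ℝ) : (mk x y z).y = y := rfl
@[simp] theorem z_mk (x y : Fin d → ℝ) (z : ℝ) : (mk x y z).z = z := rfl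

theorem ext {X Y : heis d} (hx : X.x = Y.x) (hy : X.y = Y.y)
    (hz : X.z = Y.z) : X = Y := by
  obtain ⟨_, x, y, z, rfl⟩ := X
  obtain ⟨_, x', y', z', rfl⟩ := Y
  change x = x' at hx
  change y = y' at hy
  change z = z' at hz
  subst hx hy hz
  rfl

@[simp] theorem x_add (X Y : heis d) : (X + Y).x = X.x + Y.x := rfl
@[simp] theorem y_add (X Y : heis d) : (X + Y).y = X.y + Y.y := rfl
@[simp] theorem z_add (X Y : heis d) : (X + Y).z = X.z + Y.z := rfl
@[simp] theorem x_sub (X Y : heis d) : (X - Y).x = X.x - Y.x := rfl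
@[simp] theorem y_sub (X Y : heis d) : (X - Y).y = X.y - Y.y := rfl
@[simp] theorem z_sub (X Y : heis d) : (X - Y).z = X.z - Y.z := rfl
@[simp] theorem x_smul (r : ℝ) (X : heis d) : (r • X).x = r • X.x := rfl
@[simp] theorem y_smul (r : ℝ) (X : heis d) : (r • X).y = r • X.y := rfl
@[simp] theorem z_smul (r : ℝ) (X : heis d) : (r • X).z = r * X.z := rfl

theorem lie_eq (X Y : heis d) :
    ⁅X, Y⁆ = mk 0 0 (X.x ⬝ᵥ Y.y - Y.x ⬝ᵥ X.y) := by
  obtain ⟨_, x, y, z, rfl⟩ := X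
  obtain ⟨_, x', y', z', rfl⟩ := Y
  exact Subtype.ext (heisMat_lie ..)

@[simp] theorem x_lie (X Y : heis d) : ⁅X, Y⁆.x = 0 := by rw [lie_eq]; rfl
@[simp] theorem y_lie (X Y : heis d) : ⁅X, Y⁆.y = 0 := by rw [lie_eq]; rfl
@[simp] theorem z_lie (X Y : heis d) :
    ⁅X, Y⁆.z = X.x ⬝ᵥ Y.y - Y.x ⬝ᵥ X.y := by rw [lie_eq]; rfl

end heis

/-- `{X₁, Y₁, …, X_d, Y_d, Z}` is a basis of `𝔥_d` with the Heisenberg commutation relations: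
`[X_i, Y_i] = Z`, and all other brackets of basis elements are zero. -/
structure IsHeisenbergBasis {d : ℕ} (X Y : Fin d → heis d)
    (Z : heis d) : Prop where
  linearIndependent : LinearIndependent ℝ (Sum.elim X (Sum.elim Y fun _ : Unit => Z))
  span_eq_top : Submodule.span ℝ (Set.range (Sum.elim X (Sum.elim Y fun _ : Unit => Z))) = ⊤
  lie_X_Y : ∀ i, ⁅X i, Y i⁆ = Z
  lie_X_Y_of_ne : ∀ i j, i ≠ j → ⁅X i, Y j⁆ = 0
  lie_X_X : ∀ i j, ⁅X i, X j⁆ = 0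
  lie_Y_Y : ∀ i j, ⁅Y i, Y j⁆ = 0
  lie_X_Z : ∀ i, ⁅X i, Z⁆ = 0
  lie_Y_Z : ∀ i, ⁅Y i, Z⁆ = 0

/-! ### The Lie algebra `𝔰𝔩₂ ⋉ 𝔥_d` -/

/-- The derivation `(x, y, z) ↦ (α x + β y, γ x - α y, 0)` of `𝔥_d`, for the matrix `A` with rows
`(α, β)` and `(γ, -α)`. -/
def rhoDerivation {d : ℕ} (A : sl2) :
    LieDerivation ℝ (heis d) (heis d) where
  toFun X := .mk (A.1 0 0 • X.x + A.1 0 1 • X.y) (A.1 1 0 • X.x - A.1 0 0 • X.y) 0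
  map_add' X Y := by
    apply heis.ext <;> simp <;> module
  map_smul' r X := by
    apply heis.ext <;> simp <;> module
  leibniz' X Y := by
    apply heis.ext
    · simp
    · simp
    · simp [dotProduct_comm]
      ring

theorem sl2_apply_one_one (A : sl2) : A.1 1 1 = -A.1 0 0 := by
  have h : Matrix.trace A.1 = 0 := A.2
  rw [Matrix.trace_fin_two] at h
  linarith

/-- The homomorphism `ρ` from `𝔰𝔩₂` to the derivations of `𝔥_d`. -/
def rho (d : ℕ) :
    sl2 →ₗ⁅ℝ⁆ LieDerivation ℝ (heis d) (heis d) where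
  toFun := rhoDerivation
  map_add' A B := by
    ext X : 1
    apply heis.ext <;> simp [rhoDerivation] <;> module
  map_smul' r A := by
    ext X : 1
    apply heis.ext <;> simp [rhoDerivation] <;> module
  map_lie' {A B} := by
    have hA := sl2_apply_one_one A
    have hB := sl2_apply_one_one B
    ext X : 1
    apply heis.ext <;> simp [rhoDerivation, Ring.lie_def, Matrix.mul_apply, hA, hB] <;> module

/-- The Lie algebra `𝔰𝔩₂ ⋉ 𝔥_d`, with bracket
`[(A, X), (B, Y)] = ([A, B], [X, Y] + ρ(A) Y - ρ(B) X)`. -/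
abbrev JacobiAlgebra (d : ℕ) : Type := LieAlgebra.SemiDirectSum (heis d) sl2 (rho d)

/-! ### The Lie group `SL₂ ⋉ H_d` -/

/-- The Heisenberg group `H_d`: the element with coordinates `x`, `y`, `z` stands for the
upper unitriangular matrix with rows `(1, x, z)`, `(0, 1_d, yᵀ)`, `(0, 0, 1)`. -/
@[ext] structure HeisenbergGroup (d : ℕ) where
  x : Fin d → ℝ
  y : Fin d → ℝ
  z : ℝ

namespace HeisenbergGroup

variable {d : ℕ}

/-- The unitriangular matrix of an element of `H_d`. -/
def toMatrix (h : HeisenbergGroup d) : Matrix (HIdx d) (HIdx d) ℝ := 1 + heisMat h.x h.y h.z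

instance : One (HeisenbergGroup d) := ⟨⟨0, 0, 0⟩⟩
instance : Mul (HeisenbergGroup d) :=
  ⟨fun h k => ⟨h.x + k.x, h.y + k.y, h.z + k.z + h.x ⬝ᵥ k.y⟩⟩
instance : Inv (HeisenbergGroup d) := ⟨fun h => ⟨-h.x, -h.y, -h.z + h.x ⬝ᵥ h.y⟩⟩

@[simp] theorem one_x : (1 : HeisenbergGroup d).x = 0 := rfl
@[simp] theorem one_y : (1 : HeisenbergGroup d).y = 0 := rfl
@[simp] theorem one_z : (1 : HeisenbergGroup d).z = 0 := rfl
@[simp] theorem mul_x (h k : HeisenbergGroup d) : (h * k).x = h.x + k.x := rfl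
@[simp] theorem mul_y (h k : HeisenbergGroup d) : (h * k).y = h.y + k.y := rfl
@[simp] theorem mul_z (h k : HeisenbergGroup d) : (h * k).z = h.z + k.z + h.x ⬝ᵥ k.y := rfl
@[simp] theorem inv_x (h : HeisenbergGroup d) : (h⁻¹).x = -h.x := rfl
@[simp] theorem inv_y (h : HeisenbergGroup d) : (h⁻¹).y = -h.y := rfl
@[simp] theorem inv_z (h : HeisenbergGroup d) : (h⁻¹).z = -h.z + h.x ⬝ᵥ h.y := rfl

instance : Group (HeisenbergGroup d) where
  mul_assoc h k l := by ext <;> simp <;> ring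
  one_mul h := by ext <;> simp
  mul_one h := by ext <;> simp
  inv_mul_cancel h := by ext <;> simp

/-- The group law is the multiplication of unitriangular matrices. -/
theorem toMatrix_mul (h k : HeisenbergGroup d) : (h * k).toMatrix = h.toMatrix * k.toMatrix := by
  simp only [toMatrix, mul_add, add_mul, one_mul, mul_one, heisMat_mul, mul_x, mul_y, mul_z]
  rw [add_assoc 1, heisMat_add, heisMat_add]
  simp only [add_zero]
  rw [add_assoc h.z]

/-- The linear action of `SL₂(ℝ)` on `𝔥_d`, the differential at the identity of `act`. -/
def linAct (g : SL2) (X : heis d) : heis d :=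
  .mk (g.1 0 0 • X.x + g.1 0 1 • X.y) (g.1 1 0 • X.x + g.1 1 1 • X.y) X.z

/-- The automorphism of `H_d` by which `g ∈ SL₂(ℝ)` acts. It is the one with differential
`(x, y, z) ↦ (g₀₀ x + g₀₁ y, g₁₀ x + g₁₁ y, z)` on `𝔥_d`; since the exponential of the
element `(x, y, z)` of `𝔥_d` has coordinates `(x, y, z + x ⬝ y / 2)`, the formula in these matrix
coordinates carries a quadratic correction of `z`. -/
def act (g : SL2) (h : HeisenbergGroup d) : HeisenbergGroup d where
  x := g.1 0 0 • h.x + g.1 0 1 • h.y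
  y := g.1 1 0 • h.x + g.1 1 1 • h.y
  z := h.z - h.x ⬝ᵥ h.y / 2 +
    (g.1 0 0 • h.x + g.1 0 1 • h.y) ⬝ᵥ (g.1 1 0 • h.x + g.1 1 1 • h.y) / 2

theorem act_one (h : HeisenbergGroup d) : act 1 h = h := by
  ext <;> simp [act]

theorem act_act (g g' : SL2) (h : HeisenbergGroup d) : act g (act g' h) = act (g * g') h := by
  ext <;> simp [act, Matrix.mul_apply] <;> ring

theorem act_mul (g : SL2) (h k : HeisenbergGroup d) : act g (h * k) = act g h * act g k := by
  have hdet : g.1 0 0 * g.1 1 1 - g.1 0 1 * g.1 1 0 = 1 := by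
    rw [← Matrix.det_fin_two]; exact g.2
  ext
  · simp [act]; ring
  · simp [act]; ring
  · simp [act, dotProduct_comm]
    linear_combination ((k.x ⬝ᵥ h.y - h.x ⬝ᵥ k.y) / 2) * hdet

open scoped Matrix.Norms.Elementwise in
theorem hasDerivAt_matrix_iff {m n : Type} [Fintype m] [Fintype n] {f : ℝ → Matrix m n ℝ}
    {f' : Matrix m n ℝ} {t : ℝ} :
    HasDerivAt f f' t ↔ ∀ i j, HasDerivAt (fun s => f s i j) (f' i j) t :=
  hasDerivAt_pi.trans (forall_congr' fun _ => hasDerivAt_pi)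

theorem hasDerivAt_heisMat_iff {x y : ℝ → Fin d → ℝ} {z : ℝ → ℝ} {X : heis d} {t : ℝ} :
    HasDerivAt (fun s => heisMat (x s) (y s) (z s)) X.1 t ↔
      HasDerivAt x X.x t ∧ HasDerivAt y X.y t ∧ HasDerivAt z X.z t := by
  rw [hasDerivAt_matrix_iff, hasDerivAt_pi, hasDerivAt_pi]
  obtain ⟨_, x', y', z', rfl⟩ := X
  constructor
  · intro h
    exact ⟨fun i => h (.inl ()) (.inr (.inl i)), fun i => h (.inr (.inl i)) (.inr (.inr ())),
      h (.inl ()) (.inr (.inr ()))⟩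
  · rintro ⟨hx, hy, hz⟩ i j
    rcases i with i | i | i <;> rcases j with j | j | j
    any_goals exact hasDerivAt_const t (0 : ℝ)
    exacts [hx j, hz, hy i]

theorem hasDerivAt_toMatrix_iff {γ : ℝ → HeisenbergGroup d} {X : heis d} {t : ℝ} :
    HasDerivAt (fun s => (γ s).toMatrix) X.1 t ↔
      HasDerivAt (fun s => (γ s).x) X.x t ∧ HasDerivAt (fun s => (γ s).y) X.y t ∧
        HasDerivAt (fun s => (γ s).z) X.z t := by
  rw [← hasDerivAt_heisMat_iff, hasDerivAt_matrix_iff, hasDerivAt_matrix_iff]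
  simp only [toMatrix, Matrix.add_apply, hasDerivAt_const_add_iff]

/-- The differential of the automorphism `act g` at the identity is `linAct g`. -/
theorem hasDerivAt_act (g : SL2) {γ : ℝ → HeisenbergGroup d} {X : heis d} (h0 : γ 0 = 1)
    (h : HasDerivAt (fun s => (γ s).toMatrix) X.1 0) :
    HasDerivAt (fun s => (act g (γ s)).toMatrix) (linAct g X).1 0 := by
  rw [hasDerivAt_toMatrix_iff] at h ⊢
  obtain ⟨hx, hy, hz⟩ := h
  have dot : ∀ {u v : ℝ → Fin d → ℝ} {u' v' : Fin d → ℝ}, HasDerivAt u u' 0 →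
      HasDerivAt v v' 0 → u 0 = 0 → v 0 = 0 → HasDerivAt (fun s => u s ⬝ᵥ v s) 0 0 := by
    intro u v u' v' hu hv hu0 hv0
    have := HasDerivAt.fun_sum (u := Finset.univ) fun i _ =>
      (hasDerivAt_pi.1 hu i).mul (hasDerivAt_pi.1 hv i)
    simpa [dotProduct, hu0, hv0] using this
  have hx' := (hx.const_smul (g.1 0 0)).add (hy.const_smul (g.1 0 1))
  have hy' := (hx.const_smul (g.1 1 0)).add (hy.const_smul (g.1 1 1))
  refine ⟨hx', hy', ?_⟩
  have h1 := dot hx hy (by simp [h0]) (by simp [h0])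
  have h2 := dot hx' hy' (by simp [h0]) (by simp [h0])
  have h3 := (hz.sub (h1.div_const 2)).add (h2.div_const 2)
  rw [zero_div, sub_zero, add_zero] at h3
  exact h3

/-- The differential at the identity of the linear action of `SL₂(ℝ)` on `𝔥_d` is `ρ`. Hence
`𝔰𝔩₂ ⋉ 𝔥_d` is the Lie algebra of the semidirect product `SL₂ ⋉ H_d` built on `act`. -/
theorem hasDerivAt_linAct (X : heis d) {g : ℝ → SL2} {A : sl2} (_h0 : g 0 = 1)
    (h : HasDerivAt (fun s => (g s).1) A.1 0) :
    HasDerivAt (fun s => (linAct (g s) X).1) (rho d A X).1 0 := by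
  rw [hasDerivAt_matrix_iff] at h
  have hA := sl2_apply_one_one A
  refine hasDerivAt_heisMat_iff.2 ⟨?_, ?_, ?_⟩
  · exact ((h 0 0).smul_const X.x).add ((h 0 1).smul_const X.y)
  · have := ((h 1 0).smul_const X.x).add ((h 1 1).smul_const X.y)
    rw [hA, neg_smul, ← sub_eq_add_neg] at this
    exact this
  · exact hasDerivAt_const _ _

/-- The action of `SL₂(ℝ)` on `H_d` by automorphisms. -/
def action (d : ℕ) : SL2 →* MulAut (HeisenbergGroup d) where
  toFun g :=
    { toFun := act g
      invFun := act g⁻¹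
      left_inv := fun h => by rw [act_act, inv_mul_cancel, act_one]
      right_inv := fun h => by rw [act_act, mul_inv_cancel, act_one]
      map_mul' := act_mul g }
  map_one' := by ext1 h; exact act_one h
  map_mul' g g' := by ext1 h; exact (act_act g g' h).symm

end HeisenbergGroup

/-- The Lie group `SL₂ ⋉ H_d`. -/
abbrev JacobiGroup (d : ℕ) : Type :=
  SemidirectProduct (HeisenbergGroup d) SL2 (HeisenbergGroup.action d)

namespace JacobiGroup

/-- The embedding of `SL₂ ⋉ H_d` in `Mat_{d+2} × Mat_2`. -/
def coord {d : ℕ} (q : JacobiGroup d) :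
    Matrix (HIdx d) (HIdx d) ℝ × Matrix (Fin 2) (Fin 2) ℝ :=
  (q.left.toMatrix, q.right.1)

/-- The tangent space of `SL₂ ⋉ H_d` at the identity is `𝔥_d × 𝔰𝔩₂`. -/
def tangent (d : ℕ) : JacobiAlgebra d →ₗ[ℝ]
    Matrix (HIdx d) (HIdx d) ℝ × Matrix (Fin 2) (Fin 2) ℝ where
  toFun ξ := (ξ.left.1, ξ.right.1)
  map_add' _ _ := rfl
  map_smul' _ _ := rfl

/-- The control fields `b, X₁, …, X_d, Z` on `SL₂ ⋉ H_d`, with controls `u₀, u₁, …, u_d, r`. -/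
def controls {d : ℕ} (b : sl2) (X : Fin d → heis d) (Z : heis d) :
    Unit ⊕ Fin d ⊕ Unit → JacobiAlgebra d
  | .inl _ => LieAlgebra.SemiDirectSum.inr (rho d) b
  | .inr (.inl i) => LieAlgebra.SemiDirectSum.inl (rho d) (X i)
  | .inr (.inr _) => LieAlgebra.SemiDirectSum.inl (rho d) Z

end JacobiGroup

end

/-!
The small-time reachable elements form a submonoid, because trajectories can be concatenated
(`ControlAffine.smallTimeReachable`). Constant controls give one-parameter subgroups, and it is
enough to exhibit, inside the submonoid they generate, a set of generators of the group that is
reached in arbitrarily small time.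

For `SL₂(ℝ)`, the triple `a`, `b`, `c` is conjugate in `GL₂(ℝ)` to the standard one
(`IsSl2Basis.exists_conj`). With the control `-ω²` the flow of `a - ω² b` is a conjugated rotation
of angular velocity `ω`, whose quarter turn takes time `π / (2 ω)`. The product of two fast quarter
turns of frequencies `ω₁` and `ω₂` is, up to sign, the diagonal matrix with entries `ω₁ / ω₂` and
`ω₂ / ω₁`: hence all positive diagonal matrices are reached exactly in small time. Multiplication by
diagonal matrices turns a fast quarter turn into the standard one, and conjugation by them changes
the time parameter of the unipotent flow of `a`. These elements generate `SL₂(ℝ)` as a monoid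
(`SL2.mem_of_generators`, `SL2.map_mem_smallTimeReachable`).

In `SL₂ ⋉ H_d` the same argument reaches all of `SL₂(ℝ)`. As `A = a - ω² b` acts invertibly on the
Heisenberg algebra modulo its center, the flow of `A + V` with `V` in the span of the `X i` is, up
to a central factor, the flow of `A` conjugated by an element of `H_d`. At half the period the
flow of `A` is `-1`, and there the conjugated flow gives a multiple of `V` modulo the center, up to
factors in `SL₂(ℝ)`; the central component is arbitrary thanks to the control along `Z`
(`JacobiGroup.inl_mem_smallTimeReachable_of_span`). Finally the span of the `X i` is Lagrangian
modulo the center, so that its translates under `SL₂(ℝ)` span everything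
(`IsHeisenbergBasis.submodule_eq_top`).
-/

noncomputable section

/-! ### Concatenation of trajectories -/

namespace ControlAffine

variable {G : Type*} [Group G] {E : Type*} [NormedAddCommGroup E] [NormedSpace ℝ E]
  {𝔤 : Type*} [AddCommGroup 𝔤] [Module ℝ 𝔤] {κ : Type*} [Fintype κ]

/-- In the coordinates `coord`, every left translation is the restriction of a continuous map of
the ambient vector space. -/
def HasContinuousLeftMul (coord : G → E) : Prop :=
  ∀ g : G, ∃ f : E → E, Continuous f ∧ ∀ h, coord (g * h) = f (coord h)

/-- The elements reached from the identity in some time `τ ∈ [0, T]`. -/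
def reachableSet (coord : G → E) (tangent : 𝔤 →ₗ[ℝ] E) (a : 𝔤) (b : κ → 𝔤) (T : ℝ) : Set G :=
  {g | ∃ τ ∈ Set.Icc 0 T, ∃ u : ℝ → κ → ℝ, IsPiecewiseConstant u τ ∧
    ∃ q : ℝ → G, IsTrajectory coord tangent a b u τ q ∧ q τ = g}

theorem HasLeftVelocityAt.congr {coord : G → E} {q q' : ℝ → G} {ξ : E} {t : ℝ}
    (h : HasLeftVelocityAt coord q ξ t) (hq : q' =ᶠ[nhds t] q) :
    HasLeftVelocityAt coord q' ξ t := by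
  refine HasDerivAt.congr_of_eventuallyEq h ?_
  filter_upwards [hq] with s hs
  rw [hs, hq.self_of_nhds]

theorem HasLeftVelocityAt.mul_left_comp_sub {coord : G → E} {q : ℝ → G} {ξ : E} {t : ℝ} (g : G)
    (σ : ℝ) (h : HasLeftVelocityAt coord q ξ (t - σ)) :
    HasLeftVelocityAt coord (fun s => g * q (s - σ)) ξ t := by
  have := HasDerivAt.comp_sub_const t σ h
  unfold HasLeftVelocityAt
  convert this using 2 with s
  group

variable {coord : G → E} {tangent : 𝔤 →ₗ[ℝ] E} {a : 𝔤} {b : κ → 𝔤}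

/-- A one-parameter subgroup whose velocity at the identity is a value of the control system is
a trajectory for a constant control. -/
theorem mem_reachableSet_of_oneParameter (hc : HasContinuousLeftMul coord) (q : ℝ → G)
    (hq : ∀ s t, q (s + t) = q s * q t) (v : κ → ℝ)
    (hd : HasDerivAt (fun s => coord (q s)) (tangent (a + ∑ i, v i • b i)) 0) {t : ℝ}
    (ht : 0 ≤ t) : q t ∈ reachableSet coord tangent a b t := by
  have h0 : q 0 = 1 := by simpa using hq 0 0
  have hsub : ∀ s t, q s = q t * q (s - t) := fun s t => by rw [← hq]; congr 1; ring
  refine ⟨t, ⟨ht, le_rfl⟩, fun _ => v, ⟨∅, fun _ _ _ _ _ _ => rfl⟩, q, ⟨h0, ?_, ∅, ?_⟩, rfl⟩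
  · refine Continuous.continuousOn (continuous_iff_continuousAt.2 fun s₀ => ?_)
    obtain ⟨f, hf, hfq⟩ := hc (q s₀)
    have : (fun s => coord (q s)) = fun s => f (coord (q (s - s₀))) := by
      funext s
      rw [← hfq, ← hsub]
    rw [this]
    refine hf.continuousAt.comp ?_
    have h1 : ContinuousAt (fun s => coord (q s)) (s₀ - s₀) := by
      rw [sub_self]; exact hd.continuousAt
    exact ContinuousAt.comp (f := fun s => s - s₀) h1 (by fun_prop)
  · intro s₀ _ _
    have h1 : HasDerivAt (fun s => coord (q s)) (tangent (a + ∑ i, v i • b i)) (s₀ - s₀) := by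
      rwa [sub_self]
    have := h1.comp_sub_const s₀ s₀
    unfold HasLeftVelocityAt
    convert this using 3 with s
    rw [hsub s s₀, inv_mul_cancel_left]

theorem mul_mem_reachableSet (hc : HasContinuousLeftMul coord) {g h : G} {S T : ℝ}
    (hg : g ∈ reachableSet coord tangent a b S) (hh : h ∈ reachableSet coord tangent a b T) :
    g * h ∈ reachableSet coord tangent a b (S + T) := by
  classical
  obtain ⟨σ, ⟨hσ0, hσS⟩, u, ⟨F, hu⟩, q, ⟨hq0, hqc, F', hq⟩, rfl⟩ := hg
  obtain ⟨τ, ⟨hτ0, hτT⟩, v, ⟨K, hv⟩, p, ⟨hp0, hpc, K', hp⟩, rfl⟩ := hh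
  let w : ℝ → κ → ℝ := fun t => if t ≤ σ then u t else v (t - σ)
  let r : ℝ → G := fun t => if t ≤ σ then q t else q σ * p (t - σ)
  have hr : ∀ t, σ ≤ t → r t = q σ * p (t - σ) := by
    intro t ht
    rcases ht.eq_or_lt with rfl | ht
    · simp [r, hp0]
    · simp [r, not_le.2 ht]
  refine ⟨σ + τ, ⟨by linarith, by linarith⟩, w,
    ⟨insert σ (F ∪ K.image (· + σ)), fun s t hs hst ht hd => ?_⟩, r,
    ⟨by simp [r, hσ0, hq0], ?_, insert σ (F' ∪ K'.image (· + σ)), fun t ht htF => ?_⟩, ?_⟩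
  · rw [Set.disjoint_left] at hd
    have hσ : ¬ (s ≤ σ ∧ σ ≤ t) := fun h => hd h (by simp)
    by_cases htσ : t ≤ σ
    · simp only [w, htσ, hst.trans htσ, if_true]
      refine hu s t hs hst htσ (Set.disjoint_left.2 fun x hx hxF => hd hx ?_)
      rw [Finset.mem_coe] at hxF ⊢
      simp [hxF]
    · have hsσ : ¬ s ≤ σ := fun h => hσ ⟨h, (not_le.1 htσ).le⟩
      simp only [w, htσ, hsσ, if_false]
      refine hv _ _ (by linarith) (by linarith) (by linarith)
        (Set.disjoint_left.2 fun x hx hxF => hd (a := x + σ) ⟨?_, ?_⟩ ?_)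
      · linarith [hx.1]
      · linarith [hx.2]
      · rw [Finset.mem_coe] at hxF ⊢
        simp [hxF]
  · have h1 : ContinuousOn (fun t => coord (r t)) (Set.Icc 0 σ) :=
      hqc.congr fun t ht => by simp [r, ht.2]
    have h2 : ContinuousOn (fun t => coord (r t)) (Set.Icc σ (σ + τ)) := by
      obtain ⟨f, hf, hfq⟩ := hc (q σ)
      have : ContinuousOn (fun t => f (coord (p (t - σ)))) (Set.Icc σ (σ + τ)) := by
        refine hf.comp_continuousOn (ContinuousOn.comp (f := fun t => t - σ) hpc (by fun_prop) ?_)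
        intro t ht
        exact ⟨by linarith [ht.1], by linarith [ht.2]⟩
      refine this.congr fun t ht => ?_
      simp only [hr t ht.1, hfq]
    have := h1.union_of_isClosed h2 isClosed_Icc isClosed_Icc
    rwa [Set.Icc_union_Icc_eq_Icc hσ0 (by linarith)] at this
  · simp only [Finset.mem_insert, Finset.mem_union, not_or] at htF
    rcases lt_or_gt_of_ne htF.1 with hlt | hgt
    · have := hq t ⟨ht.1, hlt⟩ htF.2.1
      simp only [w, hlt.le, if_true]
      refine this.congr ?_
      filter_upwards [Iio_mem_nhds hlt] with s hs
      simp [r, (Set.mem_Iio.1 hs).le]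
    · have := hp (t - σ) ⟨by linarith, by linarith [ht.2]⟩ fun hK =>
        htF.2.2 (Finset.mem_image.2 ⟨_, hK, by ring⟩)
      simp only [w, not_le.2 hgt, if_false]
      refine (this.mul_left_comp_sub (q σ) σ).congr ?_
      filter_upwards [Ioi_mem_nhds hgt] with s hs
      exact hr s (Set.mem_Ioi.1 hs).le
  · rw [hr _ (by linarith)]
    simp

theorem one_mem_reachableSet {T : ℝ} (hT : 0 ≤ T) :
    1 ∈ reachableSet coord tangent a b T :=
  ⟨0, ⟨le_rfl, hT⟩, 0, ⟨∅, fun _ _ _ _ _ _ => rfl⟩, fun _ => 1,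
    ⟨rfl, continuousOn_const, ∅, fun _ ht => absurd (ht.1.trans ht.2) (lt_irrefl _)⟩, rfl⟩

variable (tangent a b) in
/-- The small-time reachable elements form a submonoid. -/
def smallTimeReachable (hc : HasContinuousLeftMul coord) : Submonoid G where
  carrier := {g | IsSmallTimeReachable coord tangent a b g}
  one_mem' := fun _ hT => one_mem_reachableSet hT.le
  mul_mem' {g h} hg hh := fun T hT => by
    have := mul_mem_reachableSet hc (hg (T / 2) (by linarith)) (hh (T / 2) (by linarith))
    rwa [add_halves] at this

/-- To be small-time reachable it is enough to be reached in arbitrarily small time up to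
small-time reachable factors on both sides. -/
theorem mem_smallTimeReachable_of_sandwich (hc : HasContinuousLeftMul coord) {g : G}
    (H : ∀ T, 0 < T → ∃ s ∈ smallTimeReachable tangent a b hc,
      ∃ k ∈ reachableSet coord tangent a b T,
      ∃ s' ∈ smallTimeReachable tangent a b hc, g = s * k * s') :
    g ∈ smallTimeReachable tangent a b hc := by
  intro T hT
  obtain ⟨s, hs, k, hk, s', hs', rfl⟩ := H (T / 3) (by linarith)
  have := mul_mem_reachableSet hc (mul_mem_reachableSet hc (hs (T / 3) (by linarith)) hk)
    (hs' (T / 3) (by linarith))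
  rwa [show T / 3 + T / 3 + T / 3 = T by ring] at this

end ControlAffine

/-! ### Generation of `SL₂(ℝ)` in small time -/

namespace SL2

/-- The unipotent matrix with rows `(1, 0)` and `(t, 1)`. -/
def lower (t : ℝ) : SL2 := ⟨!![1, 0; t, 1], by simp⟩

/-- The matrix with rows `(cos ωt, -ω sin ωt)` and `(sin ωt / ω, cos ωt)`, which is the exponential
of `t` times the matrix with rows `(0, -ω²)` and `(1, 0)`. -/
def rot (ω : ℝ) (hω : ω ≠ 0) (t : ℝ) : SL2 :=
  ⟨!![Real.cos (ω * t), -ω * Real.sin (ω * t); Real.sin (ω * t) / ω, Real.cos (ω * t)], by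
    rw [Matrix.det_fin_two_of]
    field_simp
    linear_combination Real.cos_sq_add_sin_sq (ω * t)⟩

/-- The diagonal matrix with entries `m` and `m⁻¹`. -/
def diag (m : ℝ) (hm : m ≠ 0) : SL2 := ⟨!![m, 0; 0, m⁻¹], by simp [hm]⟩

/-- The value of `rot ω` at a quarter of its period. -/
def quarter (ω : ℝ) (hω : ω ≠ 0) : SL2 := ⟨!![0, -ω; ω⁻¹, 0], by simp [hω]⟩

theorem ext_entries {g h : SL2} (h00 : g.1 0 0 = h.1 0 0) (h01 : g.1 0 1 = h.1 0 1)
    (h10 : g.1 1 0 = h.1 1 0) (h11 : g.1 1 1 = h.1 1 1) : g = h := by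
  apply Subtype.ext
  ext i j
  fin_cases i <;> fin_cases j <;> assumption

theorem val_lower (t : ℝ) : (lower t).1 = !![1, 0; t, 1] := rfl

theorem val_rot (ω : ℝ) (hω : ω ≠ 0) (t : ℝ) : (rot ω hω t).1 =
    !![Real.cos (ω * t), -ω * Real.sin (ω * t); Real.sin (ω * t) / ω, Real.cos (ω * t)] := rfl

theorem val_diag (m : ℝ) (hm : m ≠ 0) : (diag m hm).1 = !![m, 0; 0, m⁻¹] := rfl

theorem val_quarter (ω : ℝ) (hω : ω ≠ 0) : (quarter ω hω).1 = !![0, -ω; ω⁻¹, 0] := rfl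

theorem lower_add (s t : ℝ) : lower (s + t) = lower s * lower t := by
  apply ext_entries <;> simp [val_lower, Matrix.mul_apply]

theorem rot_add (ω : ℝ) (hω : ω ≠ 0) (s t : ℝ) : rot ω hω (s + t) = rot ω hω s * rot ω hω t := by
  apply ext_entries <;>
    simp [val_rot, Matrix.mul_apply, mul_add, Real.cos_add, Real.sin_add] <;>
    field_simp <;> ring

theorem rot_quarter (ω : ℝ) (hω : ω ≠ 0) : rot ω hω (Real.pi / (2 * ω)) = quarter ω hω := by
  have : ω * (Real.pi / (2 * ω)) = Real.pi / 2 := by field_simp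
  apply ext_entries <;> simp [val_rot, val_quarter, this]

theorem rot_half (ω : ℝ) (hω : ω ≠ 0) : rot ω hω (Real.pi / ω) = -1 := by
  have : ω * (Real.pi / ω) = Real.pi := by field_simp
  apply ext_entries <;> simp [val_rot, this]

/-- A submonoid of `SL₂(ℝ)` that contains the positive diagonal matrices, the rotation by a right
angle and the lower unipotent matrices with nonnegative entries is everything. -/
theorem mem_of_generators (N : Submonoid SL2)
    (hD : ∀ m (hm : 0 < m), diag m hm.ne' ∈ N) (hJ : quarter 1 one_ne_zero ∈ N)
    (hL : ∀ t, 0 ≤ t → lower t ∈ N) (g : SL2) : g ∈ N := by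
  have hJ3 := N.pow_mem hJ 3
  have hneg : (-1 : SL2) ∈ N := by
    convert N.pow_mem hJ 2 using 1
    apply ext_entries <;>
      simp [val_quarter, Matrix.mul_apply, pow_succ]
  -- from `J = lower 1 * U * lower 1`, where `J` is the right angle rotation, `J⁻¹ = J ^ 3` and
  -- `U = J * lower 1 * J⁻¹` is upper unipotent
  have hL1 : lower (-1) ∈ N := by
    convert N.mul_mem (N.mul_mem (N.mul_mem (N.mul_mem hJ (hL 1 zero_le_one)) hJ3)
      (hL 1 zero_le_one)) hJ3 using 1
    apply ext_entries <;> simp [val_quarter, val_lower, Matrix.mul_apply, pow_succ]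
  have hL' : ∀ t, lower t ∈ N := by
    intro t
    rcases le_or_gt 0 t with ht | ht
    · exact hL t ht
    have hs : 0 < Real.sqrt (-t) := Real.sqrt_pos.2 (by linarith)
    have hsq : Real.sqrt (-t) * Real.sqrt (-t) = -t := Real.mul_self_sqrt (by linarith)
    convert N.mul_mem (N.mul_mem (hD _ (inv_pos.2 hs)) hL1) (hD _ hs) using 1
    apply ext_entries <;> simp [val_diag, val_lower, Matrix.mul_apply, hs.ne', hsq]
  -- the upper unipotent matrices
  have hU : ∀ t, quarter 1 one_ne_zero * lower (-t) * quarter 1 one_ne_zero ^ 3 ∈ N := fun t =>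
    N.mul_mem (N.mul_mem hJ (hL' _)) hJ3
  have hD' : ∀ m (hm : m ≠ 0), diag m hm ∈ N := by
    intro m hm
    rcases hm.lt_or_gt with h | h
    · convert N.mul_mem hneg (hD (-m) (by linarith)) using 1
      apply ext_entries <;>
        simp [val_diag]
    · exact hD m h
  -- the big cell of the Bruhat decomposition
  have key : ∀ g : SL2, g.1 0 0 ≠ 0 → g ∈ N := by
    intro g hg
    have hdet : g.1 0 0 * g.1 1 1 - g.1 0 1 * g.1 1 0 = 1 := by
      rw [← Matrix.det_fin_two]; exact g.2
    convert N.mul_mem (N.mul_mem (hL' (g.1 1 0 / g.1 0 0)) (hD' _ hg))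
      (hU (g.1 0 1 / g.1 0 0)) using 1
    apply ext_entries <;>
      simp [val_diag, val_lower, val_quarter, Matrix.mul_apply, pow_succ, hg]
    · field_simp
    · field_simp
      linear_combination hdet
  by_cases hg : g.1 0 0 = 0
  · have hdet : g.1 0 0 * g.1 1 1 - g.1 0 1 * g.1 1 0 = 1 := by
      rw [← Matrix.det_fin_two]; exact g.2
    have h1 := N.mul_mem hJ3 (key (quarter 1 one_ne_zero * g) ?_)
    · convert h1 using 1
      rw [← mul_assoc, ← pow_succ, show quarter 1 one_ne_zero ^ (3 + 1) = 1 by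
        apply ext_entries <;> simp [val_quarter, Matrix.mul_apply, pow_succ], one_mul]
    · intro h
      have h10 : g.1 1 0 = 0 := by simpa [val_quarter, Matrix.mul_apply] using h
      rw [hg, h10] at hdet
      norm_num at hdet
  · exact key g hg

open ControlAffine in
/-- If, through a homomorphism `ψ` from `SL₂(ℝ)`, the flows `lower` and `rot ω` are available in
real time, then the whole image of `ψ` is small-time reachable: products of two fast quarter turns
are diagonal, and diagonal matrices rescale the time of `lower`. -/
theorem map_mem_smallTimeReachable {G : Type*} [Group G] {E : Type*} [NormedAddCommGroup E]
    [NormedSpace ℝ E] {𝔤 : Type*} [AddCommGroup 𝔤] [Module ℝ 𝔤] {κ : Type*} [Fintype κ]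
    {coord : G → E} {tangent : 𝔤 →ₗ[ℝ] E} {a : 𝔤} {b : κ → 𝔤} (hc : HasContinuousLeftMul coord)
    (ψ : SL2 →* G) (hL : ∀ t, 0 ≤ t → ψ (lower t) ∈ reachableSet coord tangent a b t)
    (hM : ∀ ω (hω : 0 < ω) t, 0 ≤ t → ψ (rot ω hω.ne' t) ∈ reachableSet coord tangent a b t)
    (g : SL2) : ψ g ∈ smallTimeReachable tangent a b hc := by
  have hπ := Real.pi_pos
  have hq : ∀ ω (hω : 0 < ω), ψ (quarter ω hω.ne') ∈
      reachableSet coord tangent a b (Real.pi / (2 * ω)) := by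
    intro ω hω
    rw [← rot_quarter]
    exact hM ω hω _ (by positivity)
  have hD : ∀ m (hm : 0 < m), ψ (diag m hm.ne') ∈ smallTimeReachable tangent a b hc := by
    have hneg : ∀ m (hm : 0 < m), ψ (-diag m hm.ne') ∈ smallTimeReachable tangent a b hc := by
      intro m hm T hT
      -- the frequencies `m * K` and `K` for which the two quarter turns take time exactly `T`
      have hK : 0 < Real.pi * (1 + m⁻¹) / (2 * T) := by positivity
      set K := Real.pi * (1 + m⁻¹) / (2 * T) with hKdef
      have := mul_mem_reachableSet hc (hq (m * K) (by positivity)) (hq K hK)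
      rw [← map_mul] at this
      have hT' : Real.pi / (2 * (m * K)) + Real.pi / (2 * K) = T := by
        rw [hKdef]
        field_simp
        ring
      rw [hT'] at this
      change _ ∈ reachableSet coord tangent a b T
      convert this using 2
      apply ext_entries <;>
        simp [val_quarter, val_diag, Matrix.mul_apply] <;>
        field_simp
    intro m hm
    have := mul_mem (hneg m hm) (hneg 1 one_pos)
    rw [← map_mul] at this
    convert this using 2
    apply ext_entries <;>
      simp [val_diag, Matrix.mul_apply]
  refine mem_of_generators ((smallTimeReachable tangent a b hc).comap ψ) hD ?_ ?_ g
  · refine mem_smallTimeReachable_of_sandwich hc fun T hT => ?_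
    have hω : 0 < Real.pi / (2 * T) := by positivity
    have h1 := hq _ hω
    rw [show Real.pi / (2 * (Real.pi / (2 * T))) = T by field_simp] at h1
    refine ⟨_, hD _ (inv_pos.2 hω), _, h1, 1, one_mem _, ?_⟩
    · rw [mul_one, ← map_mul]
      congr 1
      apply ext_entries <;> simp [val_diag, val_quarter, Matrix.mul_apply] <;>
        field_simp
  · intro t ht
    rcases ht.eq_or_lt with rfl | ht
    · convert one_mem ((smallTimeReachable tangent a b hc).comap ψ) using 1
      apply ext_entries <;> simp [val_lower]
    refine mem_smallTimeReachable_of_sandwich hc fun T hT => ?_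
    have hs : 0 < Real.sqrt (t / T) := Real.sqrt_pos.2 (by positivity)
    have hsq : Real.sqrt (t / T) * Real.sqrt (t / T) = t / T := Real.mul_self_sqrt (by positivity)
    refine ⟨_, hD _ (inv_pos.2 hs), _, hL T hT.le, _, hD _ hs, ?_⟩
    rw [← map_mul, ← map_mul]
    congr 1
    apply ext_entries <;> simp [val_diag, val_lower, Matrix.mul_apply, hs.ne']
    rw [mul_right_comm, hsq]
    field_simp

end SL2

/-! ### Normal form of the triple `a`, `b`, `c` -/

namespace SL2

/-- Conjugation by an invertible matrix, as an endomorphism of `SL₂(ℝ)`. -/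
def conj (P : (Matrix (Fin 2) (Fin 2) ℝ)ˣ) : SL2 →* SL2 where
  toFun g := ⟨P.1 * g.1 * P.2, by
    rw [Matrix.det_mul, Matrix.det_mul, g.2, mul_one, ← Matrix.det_mul, P.3, Matrix.det_one]⟩
  map_one' := Subtype.ext <| by
    change P.1 * 1 * P.2 = 1
    rw [mul_one, P.3]
  map_mul' g h := Subtype.ext <| by
    change P.1 * (g.1 * h.1) * P.2 = P.1 * g.1 * P.2 * (P.1 * h.1 * P.2)
    calc _ = P.1 * g.1 * 1 * h.1 * P.2 := by simp only [mul_one, mul_assoc]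
      _ = _ := by rw [← P.4]; simp only [mul_assoc]

theorem val_conj (P : (Matrix (Fin 2) (Fin 2) ℝ)ˣ) (g : SL2) :
    (conj P g).1 = P.1 * g.1 * (P⁻¹).1 := rfl

theorem conj_surjective (P : (Matrix (Fin 2) (Fin 2) ℝ)ˣ) : Function.Surjective (conj P) := by
  intro g
  refine ⟨conj P⁻¹ g, Subtype.ext ?_⟩
  simp only [val_conj, inv_inv, mul_assoc, Units.mul_inv_cancel_left, Units.mul_inv, mul_one]

end SL2

/-- A triple with the bracket relations of `a`, `b`, `c` is conjugate, in `GL₂(ℝ)`, to the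
standard one. The matrices `a` and `b` square to zero and `a b + b a = 1`, so that a nonzero `v` in
the kernel of `b` gives the basis `v, a v` in which they take their normal form. -/
theorem IsSl2Basis.exists_conj {a b c : sl2} (h : IsSl2Basis a b c) :
    ∃ P : (Matrix (Fin 2) (Fin 2) ℝ)ˣ,
      a.1 = P.1 * !![0, 0; 1, 0] * (P⁻¹).1 ∧ b.1 = P.1 * !![0, 1; 0, 0] * (P⁻¹).1 := by
  have ha := sl2_apply_one_one a
  have hb := sl2_apply_one_one b
  have hba : b.1 * a.1 - a.1 * b.1 = c.1 := congrArg Subtype.val h.lie_b_a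
  have hac : a.1 * c.1 - c.1 * a.1 = (2 : ℝ) • a.1 := congrArg Subtype.val h.lie_a_c
  have hbc : b.1 * c.1 - c.1 * b.1 = (-2 : ℝ) • b.1 := congrArg Subtype.val h.lie_b_c
  have ha0 : a ≠ 0 := h.linearIndependent.ne_zero 0
  have hb0 : b ≠ 0 := h.linearIndependent.ne_zero 1
  rw [← hba] at hac hbc
  have eac := fun i j => congrFun (congrFun hac i) j
  have ebc := fun i j => congrFun (congrFun hbc i) j
  simp only [Matrix.sub_apply, Matrix.mul_apply, Matrix.smul_apply, Fin.sum_univ_two, ha, hb,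
    smul_eq_mul] at eac ebc
  have ea00 := eac 0 0
  have ea01 := eac 0 1
  have ea10 := eac 1 0
  have eb00 := ebc 0 0
  have eb01 := ebc 0 1
  have eb10 := ebc 1 0
  simp only [ha, hb] at ea00 ea01 ea10 eb00 eb01 eb10
  have hane : ¬ (a.1 0 0 = 0 ∧ a.1 0 1 = 0 ∧ a.1 1 0 = 0) := by
    rintro ⟨h1, h2, h3⟩
    refine ha0 (Subtype.ext ?_)
    ext i j
    fin_cases i <;> fin_cases j <;> simp [h1, h2, h3, ha]
  have hbne : ¬ (b.1 0 0 = 0 ∧ b.1 0 1 = 0 ∧ b.1 1 0 = 0) := by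
    rintro ⟨h1, h2, h3⟩
    refine hb0 (Subtype.ext ?_)
    ext i j
    fin_cases i <;> fin_cases j <;> simp [h1, h2, h3, hb]
  have ha' : a.1 = !![a.1 0 0, a.1 0 1; a.1 1 0, -a.1 0 0] := by
    rw [← ha]; exact Matrix.eta_fin_two _
  have hb' : b.1 = !![b.1 0 0, b.1 0 1; b.1 1 0, -b.1 0 0] := by
    rw [← hb]; exact Matrix.eta_fin_two _
  generalize a.1 0 0 = α at *
  generalize a.1 0 1 = β at *
  generalize a.1 1 0 = γ at *
  generalize b.1 0 0 = α' at *
  generalize b.1 0 1 = β' at *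
  generalize b.1 1 0 = γ' at *
  -- `a² = 0`, `b² = 0` and `tr (a b) = 1`
  have hna : α ^ 2 + β * γ = 0 := by
    linear_combination (-α / 2) * ea00 - (γ / 4) * ea01 - (β / 4) * ea10
  have hnb : α' ^ 2 + β' * γ' = 0 := by
    linear_combination (α' / 2) * eb00 + (γ' / 4) * eb01 + (β' / 4) * eb10
  have htr : 2 * α * α' + β * γ' + γ * β' = 1 := by
    by_contra hne
    have hne' : 2 * α * α' + β * γ' + γ * β' - 1 ≠ 0 := sub_ne_zero.2 hne
    refine hane ⟨?_, ?_, ?_⟩ <;> refine (mul_eq_zero.1 ?_).resolve_right hne'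
    · linear_combination ea00 / 2 + 2 * α' * hna
    · linear_combination ea01 / 2 + 2 * β' * hna
    · linear_combination ea10 / 2 + 2 * γ' * hna
  have key : ∀ p q : ℝ, α' * p + β' * q = 0 → γ' * p - α' * q = 0 →
      p * (γ * p - α * q) - (α * p + β * q) * q ≠ 0 →
      ∃ P : (Matrix (Fin 2) (Fin 2) ℝ)ˣ,
        a.1 = P.1 * !![0, 0; 1, 0] * (P⁻¹).1 ∧ b.1 = P.1 * !![0, 1; 0, 0] * (P⁻¹).1 := by
    intro p q h1 h2 hdet
    refine ⟨Matrix.GeneralLinearGroup.mkOfDetNeZero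
      !![p, α * p + β * q; q, γ * p - α * q] (by rwa [Matrix.det_fin_two_of]), ?_, ?_⟩
    · rw [Units.eq_mul_inv_iff_mul_eq, ha']
      ext i j
      fin_cases i <;> fin_cases j <;>
        simp [Matrix.GeneralLinearGroup.mkOfDetNeZero, Matrix.mul_apply]
      · linear_combination p * hna
      · ring
      · linear_combination q * hna
    · rw [Units.eq_mul_inv_iff_mul_eq, hb']
      ext i j
      fin_cases i <;> fin_cases j <;>
        simp [Matrix.GeneralLinearGroup.mkOfDetNeZero, Matrix.mul_apply]
      · exact h1
      · linear_combination p * htr - α * h1 - β * h2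
      · linear_combination h2
      · linear_combination q * htr - γ * h1 + α * h2
  -- the kernel of `b` is spanned by either nonzero column of `b`
  by_cases hγ : γ' = 0
  · have hα : α' = 0 := by
      rw [hγ, mul_zero, add_zero] at hnb
      exact pow_eq_zero_iff two_ne_zero |>.1 hnb
    have hβ : β' ≠ 0 := fun hβ => hbne ⟨hα, hβ, hγ⟩
    refine key β' (-α') (by ring) (by linear_combination hnb) fun h0 => hβ ?_
    linear_combination h0 - β' * htr + β * hnb
  · refine key α' γ' (by linear_combination hnb) (by ring) fun h0 => hγ ?_
    linear_combination -h0 - γ' * htr + γ * hnb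

/-! ### Velocities of the one-parameter subgroups of `SL₂(ℝ)` -/

namespace SL2

open scoped Matrix.Norms.Elementwise
open ControlAffine

theorem hasDerivAt_conj (P : (Matrix (Fin 2) (Fin 2) ℝ)ˣ) {q : ℝ → SL2}
    {A : Matrix (Fin 2) (Fin 2) ℝ} {t : ℝ} (h : HasDerivAt (fun s => (q s).1) A t) :
    HasDerivAt (fun s => (conj P (q s)).1) (P.1 * A * (P⁻¹).1) t :=
  (LinearMap.toContinuousLinearMap ((LinearMap.mulRight ℝ (P⁻¹).1).comp
    (LinearMap.mulLeft ℝ P.1))).hasFDerivAt.comp_hasDerivAt t h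

theorem hasDerivAt_lower : HasDerivAt (fun s => (lower s).1) !![0, 0; 1, 0] 0 := by
  rw [HeisenbergGroup.hasDerivAt_matrix_iff]
  intro i j
  fin_cases i <;> fin_cases j
  exacts [hasDerivAt_const _ _, hasDerivAt_const _ _, hasDerivAt_id _, hasDerivAt_const _ _]

theorem hasDerivAt_rot (ω : ℝ) (hω : ω ≠ 0) :
    HasDerivAt (fun s => (rot ω hω s).1) !![0, -ω ^ 2; 1, 0] 0 := by
  have hc : HasDerivAt (fun s => Real.cos (ω * s)) 0 0 := by
    simpa using ((hasDerivAt_id (0 : ℝ)).const_mul ω).cos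
  have hs : HasDerivAt (fun s => Real.sin (ω * s)) ω 0 := by
    simpa using ((hasDerivAt_id (0 : ℝ)).const_mul ω).sin
  rw [HeisenbergGroup.hasDerivAt_matrix_iff]
  intro i j
  fin_cases i <;> fin_cases j
  · exact hc
  · have := hs.const_mul (-ω)
    rwa [show -ω * ω = -ω ^ 2 by ring] at this
  · have := hs.div_const ω
    rwa [div_self hω] at this
  · exact hc

theorem hasContinuousLeftMul_coord : HasContinuousLeftMul coord :=
  fun g => ⟨fun M => g.1 * M, by fun_prop, fun _ => rfl⟩

variable {a b : sl2} {P : (Matrix (Fin 2) (Fin 2) ℝ)ˣ}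

theorem hasDerivAt_conj_lower (ha : a.1 = P.1 * !![0, 0; 1, 0] * (P⁻¹).1) :
    HasDerivAt (fun s => (conj P (lower s)).1) a.1 0 := by
  rw [ha]
  exact hasDerivAt_conj P hasDerivAt_lower

theorem val_add_smul (ha : a.1 = P.1 * !![0, 0; 1, 0] * (P⁻¹).1)
    (hb : b.1 = P.1 * !![0, 1; 0, 0] * (P⁻¹).1) (u : ℝ) :
    (a + u • b).1 = P.1 * !![0, u; 1, 0] * (P⁻¹).1 := by
  change a.1 + u • b.1 = _
  rw [ha, hb, ← Matrix.smul_mul, ← Matrix.mul_smul, ← Matrix.add_mul, ← Matrix.mul_add]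
  congr 2
  ext i j
  fin_cases i <;> fin_cases j <;> simp

theorem hasDerivAt_conj_rot (ha : a.1 = P.1 * !![0, 0; 1, 0] * (P⁻¹).1)
    (hb : b.1 = P.1 * !![0, 1; 0, 0] * (P⁻¹).1) (ω : ℝ) (hω : ω ≠ 0) :
    HasDerivAt (fun s => (conj P (rot ω hω s)).1) (a + (-ω ^ 2) • b).1 0 := by
  rw [val_add_smul ha hb]
  exact hasDerivAt_conj P (hasDerivAt_rot ω hω)

theorem isSmallTimeControllable {c : sl2} (h : IsSl2Basis a b c) :
    IsSmallTimeControllable coord tangent a (fun _ : Unit => b) := by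
  obtain ⟨P, ha, hb⟩ := h.exists_conj
  intro g
  obtain ⟨g, rfl⟩ := conj_surjective P g
  refine map_mem_smallTimeReachable hasContinuousLeftMul_coord (conj P) (fun t ht => ?_)
    (fun ω hω t ht => ?_) g
  · refine mem_reachableSet_of_oneParameter hasContinuousLeftMul_coord
      (fun s => conj P (lower s)) (fun s t => by rw [lower_add, map_mul]) 0 ?_ ht
    simp only [Pi.zero_apply, zero_smul, Finset.sum_const_zero, add_zero]
    exact hasDerivAt_conj_lower ha
  · refine mem_reachableSet_of_oneParameter hasContinuousLeftMul_coord
      (fun s => conj P (rot ω hω.ne' s)) (fun s t => by rw [rot_add, map_mul])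
      (fun _ => -ω ^ 2) ?_ ht
    simp only [Finset.univ_unique, Finset.sum_singleton]
    exact hasDerivAt_conj_rot ha hb ω hω.ne'

end SL2

/-! ### Heisenberg bases -/

namespace IsHeisenbergBasis

variable {d : ℕ} {X Y : Fin d → heis d} {Z : heis d}

theorem exists_eq_sum (h : IsHeisenbergBasis X Y Z) (P : heis d) :
    ∃ (α β : Fin d → ℝ) (γ : ℝ),
    P = ∑ i, α i • X i + (∑ i, β i • Y i + γ • Z) := by
  have hP : P ∈ Submodule.span ℝ (Set.range (Sum.elim X (Sum.elim Y fun _ : Unit => Z))) := by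
    rw [h.span_eq_top]; trivial
  obtain ⟨c, rfl⟩ := (Submodule.mem_span_range_iff_exists_fun ℝ).1 hP
  exact ⟨fun i => c (.inl i), fun i => c (.inr (.inl i)), c (.inr (.inr ())), by
    simp [Fintype.sum_sum_type]⟩

theorem ne_zero (h : IsHeisenbergBasis X Y Z) : Z ≠ 0 := by
  simpa using h.linearIndependent.ne_zero (.inr (.inr ()))

theorem lie_Z (h : IsHeisenbergBasis X Y Z) (P : heis d) : ⁅P, Z⁆ = 0 := by
  obtain ⟨α, β, γ, rfl⟩ := h.exists_eq_sum P
  simp [add_lie, sum_lie, h.lie_X_Z, h.lie_Y_Z]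

/-- The centralizer of the `X i` is commutative, being spanned by the `X i` and `Z`. -/
theorem lie_eq_zero (h : IsHeisenbergBasis X Y Z) {P Q : heis d}
    (hP : ∀ i, ⁅X i, P⁆ = 0) (hQ : ∀ i, ⁅X i, Q⁆ = 0) :
    ⁅P, Q⁆ = 0 := by
  obtain ⟨α, β, γ, rfl⟩ := h.exists_eq_sum P
  have hβ : ∀ i, β i = 0 := by
    intro i
    have h1 := hP i
    rw [lie_add, lie_add, lie_sum, lie_sum, Finset.sum_eq_zero, Finset.sum_eq_single i] at h1
    · simpa [h.lie_X_Z, h.lie_X_Y, h.ne_zero] using h1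
    · intro j _ hj
      rw [lie_smul, h.lie_X_Y_of_ne i j hj.symm, smul_zero]
    · simp
    · intro j _
      rw [lie_smul, h.lie_X_X, smul_zero]
  have hZ : ⁅Z, Q⁆ = 0 := by rw [← lie_skew, h.lie_Z, neg_zero]
  simp [add_lie, sum_lie, hβ, hQ, hZ]

theorem Z_eq (h : IsHeisenbergBasis X Y Z) : Z = heis.mk 0 0 Z.z := by
  have hx := congrArg heis.z (h.lie_Z (heis.mk 0 Z.x 0))
  have hy := congrArg heis.z (h.lie_Z (heis.mk Z.y 0 0))
  rw [heis.z_lie] at hx hy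
  have h0 : (0 : heis d).z = 0 := rfl
  simp only [heis.x_mk, heis.y_mk, zero_dotProduct, dotProduct_zero, zero_sub, sub_zero, h0,
    neg_eq_zero, dotProduct_self_eq_zero] at hx hy
  exact heis.ext hx hy rfl

theorem z_ne_zero (h : IsHeisenbergBasis X Y Z) : Z.z ≠ 0 := fun h0 => h.ne_zero <| by
  rw [h.Z_eq, h0]
  exact heis.ext rfl rfl rfl

/-- Modulo the center, the `X i` generate the Heisenberg algebra under `SL₂(ℝ)`. An invariant
subspace of `ℝ² ⊗ ℝᵈ` has the form `ℝ² ⊗ U`; were `w ≠ 0` orthogonal to `U`, then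
`(w, 0, 0)` and `(0, w, 0)` would be noncommuting elements of the centralizer of the `X i`. -/
theorem submodule_eq_top (h : IsHeisenbergBasis X Y Z)
    (W : Submodule ℝ ((Fin d → ℝ) × (Fin d → ℝ)))
    (hX : ∀ i, ((X i).x, (X i).y) ∈ W)
    (hW : ∀ (g : SL2) x y, (x, y) ∈ W →
      (g.1 0 0 • x + g.1 0 1 • y, g.1 1 0 • x + g.1 1 1 • y) ∈ W) : W = ⊤ := by
  have hJ : ∀ x y, (x, y) ∈ W → (-y, x) ∈ W := by
    intro x y hxy
    simpa [SL2.val_quarter] using hW (SL2.quarter 1 one_ne_zero) x y hxy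
  -- `diag 2` acts with different eigenvalues on the two components
  have hfst : ∀ x y, (x, y) ∈ W → (x, 0) ∈ W := by
    intro x y hxy
    have h1 := W.smul_mem (2 / 3 : ℝ)
      (W.sub_mem (hW (SL2.diag 2 two_ne_zero) x y hxy) (W.smul_mem (1 / 2 : ℝ) hxy))
    convert h1 using 1
    ext i <;> simp [SL2.val_diag]
    ring
  let U : Submodule ℝ (Fin d → ℝ) := W.comap (LinearMap.inl ℝ _ _)
  have hU : U = ⊤ := by
    by_contra hne
    obtain ⟨f, hf0, hf⟩ := U.exists_le_ker_of_lt_top (lt_top_iff_ne_top.2 hne)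
    have hfw : ∀ x, f x = x ⬝ᵥ fun i => f fun j => if i = j then 1 else 0 := by
      intro x
      rw [LinearMap.pi_apply_eq_sum_univ f x]
      rfl
    set w : Fin d → ℝ := fun i => f fun j => if i = j then 1 else 0
    have hx : ∀ i, (X i).x ⬝ᵥ w = 0 := fun i => by
      rw [← hfw]
      exact hf (hfst _ _ (hX i))
    have hy : ∀ i, (X i).y ⬝ᵥ w = 0 := fun i => by
      rw [← hfw, ← neg_eq_zero, ← map_neg]
      exact hf (hfst _ _ (hJ _ _ (hX i)))
    have h1 : ⁅heis.mk w 0 0, heis.mk 0 w 0⁆ = 0 := by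
      refine h.lie_eq_zero (fun i => ?_) fun i => ?_
      · rw [heis.lie_eq]
        simp only [heis.x_mk, heis.y_mk, dotProduct_zero, dotProduct_comm w, hy, sub_zero]
        exact heis.ext rfl rfl rfl
      · rw [heis.lie_eq]
        simp only [heis.x_mk, heis.y_mk, zero_dotProduct, hx, sub_zero]
        exact heis.ext rfl rfl rfl
    have h2 := congrArg heis.z h1
    rw [heis.z_lie] at h2
    have h0 : (0 : heis d).z = 0 := rfl
    simp only [heis.x_mk, heis.y_mk, zero_dotProduct, sub_zero, h0, dotProduct_self_eq_zero] at h2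
    exact hf0 (LinearMap.ext fun x => by rw [hfw, h2, dotProduct_zero]; rfl)
  have hU' : ∀ x, (x, 0) ∈ W := fun x => by
    have : x ∈ U := by rw [hU]; trivial
    exact this
  rw [eq_top_iff]
  rintro ⟨x, y⟩ -
  have := W.add_mem (hU' x) (hJ _ _ (hU' y))
  simpa using this

end IsHeisenbergBasis

/-! ### Small-time reachability in `SL₂ ⋉ H_d` -/

namespace HeisenbergGroup

variable {d : ℕ}

/-- The central one-parameter subgroup of `H_d`. -/
def central (z : ℝ) : HeisenbergGroup d := ⟨0, 0, z⟩

theorem central_add (z z' : ℝ) :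
    (central (z + z') : HeisenbergGroup d) = central z * central z' := by
  ext <;> simp [central]

theorem central_mul_comm (z : ℝ) (h : HeisenbergGroup d) : central z * h = h * central z := by
  ext <;> simp [central, add_comm]

theorem act_central (g : SL2) (z : ℝ) : act g (central z : HeisenbergGroup d) = central z := by
  ext <;> simp [central, act]

theorem act_inv (g : SL2) (h : HeisenbergGroup d) : act g h⁻¹ = (act g h)⁻¹ :=
  map_inv (action d g) h

theorem mk_eq_mul_central (h : HeisenbergGroup d) (z : ℝ) :
    ⟨h.x, h.y, z⟩ = h * central (z - h.z) := by
  ext <;> simp [central]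

end HeisenbergGroup

namespace JacobiGroup

open HeisenbergGroup ControlAffine
open scoped Matrix.Norms.Elementwise

variable {d : ℕ}

theorem inl_act (g : SL2) (h : HeisenbergGroup d) :
    (SemidirectProduct.inl (act g h) : JacobiGroup d) =
      SemidirectProduct.inr g * SemidirectProduct.inl h * SemidirectProduct.inr g⁻¹ :=
  SemidirectProduct.inl_aut (φ := HeisenbergGroup.action d) g h

theorem hasContinuousLeftMul_coord : HasContinuousLeftMul (coord (d := d)) := by
  intro g
  refine ⟨fun p => ((g.left * act g.right ⟨fun k => p.1 (.inl ()) (.inr (.inl k)),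
    fun k => p.1 (.inr (.inl k)) (.inr (.inr ())), p.1 (.inl ()) (.inr (.inr ()))⟩).toMatrix,
    g.right.1 * p.2), ?_, fun h => ?_⟩
  · refine Continuous.prodMk ?_ (by fun_prop)
    refine continuous_matrix fun i j => ?_
    rcases i with i | i | i <;> rcases j with j | j | j <;>
      simp only [toMatrix, heisMat, Matrix.add_apply, Matrix.of_apply, act, mul_x, mul_y, mul_z,
        dotProduct, Pi.add_apply, Pi.smul_apply, smul_eq_mul] <;>
      fun_prop
  · refine Prod.ext ?_ rfl
    change (g.left * act g.right h.left).toMatrix = _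
    congr 3
    ext <;> simp [coord, toMatrix, heisMat]

/-- The one-parameter subgroup `t ↦ w M(t) w⁻¹ central(ζ t)` of `SL₂ ⋉ H_d` built on a
one-parameter subgroup `M` of `SL₂(ℝ)`; in the definition `w M(t) w⁻¹` is split into its
components in `H_d` and `SL₂(ℝ)`. -/
def flow (M : ℝ → SL2) (w : HeisenbergGroup d) (ζ t : ℝ) : JacobiGroup d :=
  SemidirectProduct.inl (w * act (M t) w⁻¹ * central (ζ * t)) * SemidirectProduct.inr (M t)

theorem flow_left (M : ℝ → SL2) (w : HeisenbergGroup d) (ζ t : ℝ) :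
    (flow M w ζ t).left = w * act (M t) w⁻¹ * central (ζ * t) := by
  simp [flow]

theorem flow_right (M : ℝ → SL2) (w : HeisenbergGroup d) (ζ t : ℝ) :
    (flow M w ζ t).right = M t := by
  simp [flow]

theorem flow_add {M : ℝ → SL2} (hM : ∀ s t, M (s + t) = M s * M t) (w : HeisenbergGroup d)
    (ζ s t : ℝ) : flow M w ζ (s + t) = flow M w ζ s * flow M w ζ t := by
  refine SemidirectProduct.ext ?_ ?_
  · rw [SemidirectProduct.mul_left, flow_left, flow_left, flow_left, flow_right]
    change _ = _ * act (M s) _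
    rw [act_mul, act_mul, act_central, hM, ← act_act, act_inv (M s) w, mul_add, central_add]
    generalize act (M s) (act (M t) w⁻¹) = p
    generalize act (M s) w = r
    have h1 := central_mul_comm (ζ * s) (r * p)
    calc w * p * (central (ζ * s) * central (ζ * t))
        = w * r⁻¹ * ((r * p) * central (ζ * s)) * central (ζ * t) := by group
      _ = _ := by rw [← h1]; group
  · rw [SemidirectProduct.mul_right, flow_right, flow_right, flow_right, hM]

/-- The velocity of `flow M w ζ` at the identity. The central component is an affine function
of `ζ` with slope one; its constant term is irrelevant, since the control along `Z` is free. -/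
theorem exists_hasDerivAt_flow {M : ℝ → SL2} {A : sl2}
    (hM : HasDerivAt (fun s => (M s).1) A.1 0) (w : HeisenbergGroup d) :
    ∃ κ : ℝ, ∀ ζ, HasDerivAt (fun s => coord (flow M w ζ s))
      ((heis.mk (-(A.1 0 0 • w.x + A.1 0 1 • w.y)) (-(A.1 1 0 • w.x + A.1 1 1 • w.y))
        (κ + ζ)).1, A.1) 0 := by
  have hM' := hasDerivAt_matrix_iff.1 hM
  have hd := fun i j => (hM' i j).differentiableAt
  let f : ℝ → ℝ := fun s => w.z + (act (M s) w⁻¹).z + w.x ⬝ᵥ (act (M s) w⁻¹).y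
  have hf : DifferentiableAt ℝ f 0 := by
    have h00 := hd 0 0
    have h01 := hd 0 1
    have h10 := hd 1 0
    have h11 := hd 1 1
    simp only [f, act, dotProduct, Pi.add_apply, Pi.smul_apply, smul_eq_mul]
    fun_prop
  refine ⟨deriv f 0, fun ζ => ?_⟩
  refine HasDerivAt.prodMk (f₁ := fun s => (flow M w ζ s).left.toMatrix) ?_ ?_
  · refine hasDerivAt_toMatrix_iff.2 ?_
    simp only [flow_left, heis.x_mk, heis.y_mk, heis.z_mk, mul_x, mul_y, mul_z]
    refine ⟨?_, ?_, ?_⟩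
    · have := ((((hM' 0 0).smul_const w⁻¹.x).add ((hM' 0 1).smul_const w⁻¹.y)).const_add
        w.x).add_const (central (d := d) 0).x
      refine this.congr_deriv ?_
      rw [inv_x, inv_y, smul_neg, smul_neg, neg_add]
    · have := ((((hM' 1 0).smul_const w⁻¹.x).add ((hM' 1 1).smul_const w⁻¹.y)).const_add
        w.y).add_const (central (d := d) 0).y
      refine this.congr_deriv ?_
      rw [inv_x, inv_y, smul_neg, smul_neg, neg_add]
    · have := hf.hasDerivAt.add ((hasDerivAt_id (0 : ℝ)).const_mul ζ)
      rw [mul_one] at this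
      refine this.congr_of_eventuallyEq (Filter.Eventually.of_forall fun s => ?_)
      simp [f, central]
  · simp only [flow_right]
    exact hM

variable {a b : sl2} {X Y : Fin d → heis d} {Z : heis d}

theorem tangent_controls (u₀ r : ℝ) (μ : Fin d → ℝ) :
    tangent d (LieAlgebra.SemiDirectSum.inr (rho d) a +
      ∑ i, Sum.elim (fun _ => u₀) (Sum.elim μ fun _ => r) i • controls b X Z i) =
      ((∑ i, μ i • X i + r • Z).1, (a + u₀ • b).1) := by
  have hl : ∀ W : heis d, tangent d (LieAlgebra.SemiDirectSum.inl (rho d) W) = (W.1, 0) :=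
    fun _ => rfl
  have hr : ∀ W : sl2, tangent d (LieAlgebra.SemiDirectSum.inr (rho d) W) = (0, W.1) :=
    fun _ => rfl
  simp only [Fintype.sum_sum_type, map_add, map_sum, map_smul, controls, hl, hr, Sum.elim_inl,
    Sum.elim_inr, Finset.univ_unique, Finset.sum_singleton]
  refine Prod.ext ?_ ?_
  · simp [Prod.fst_sum]
  · simp [Prod.snd_sum]

theorem flow_mem_reachableSet (h : IsHeisenbergBasis X Y Z) {M : ℝ → SL2} {u₀ : ℝ}
    (hM : ∀ s t, M (s + t) = M s * M t)
    (hMd : HasDerivAt (fun s => (M s).1) (a + u₀ • b).1 0) (w : HeisenbergGroup d)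
    (μ : Fin d → ℝ)
    (hx : (∑ i, μ i • X i).x = -((a + u₀ • b).1 0 0 • w.x + (a + u₀ • b).1 0 1 • w.y))
    (hy : (∑ i, μ i • X i).y = -((a + u₀ • b).1 1 0 • w.x + (a + u₀ • b).1 1 1 • w.y))
    (ζ : ℝ) {t : ℝ} (ht : 0 ≤ t) :
    flow M w ζ t ∈ reachableSet coord (tangent d) (LieAlgebra.SemiDirectSum.inr (rho d) a)
      (controls b X Z) t := by
  obtain ⟨κ, hκ⟩ := exists_hasDerivAt_flow hMd w
  refine mem_reachableSet_of_oneParameter hasContinuousLeftMul_coord _ (flow_add hM w ζ)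
    (Sum.elim (fun _ => u₀) (Sum.elim μ fun _ => (κ + ζ - (∑ i, μ i • X i).z) / Z.z)) ?_ ht
  rw [tangent_controls]
  have hz := h.z_ne_zero
  suffices heq : ∑ i, μ i • X i + ((κ + ζ - (∑ i, μ i • X i).z) / Z.z) • Z =
      heis.mk (-((a + u₀ • b).1 0 0 • w.x + (a + u₀ • b).1 0 1 • w.y))
        (-((a + u₀ • b).1 1 0 • w.x + (a + u₀ • b).1 1 1 • w.y)) (κ + ζ) by
    rw [heq]
    exact hκ ζ
  refine heis.ext ?_ ?_ ?_
  · rw [heis.x_add, hx, h.Z_eq]; simp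
  · rw [heis.y_add, hy, h.Z_eq]; simp
  · rw [heis.z_add, heis.z_smul, heis.z_mk]
    field_simp
    ring

end JacobiGroup

namespace JacobiGroup

open HeisenbergGroup ControlAffine
open scoped Matrix.Norms.Elementwise

variable {d : ℕ} {a b : sl2} {X Y : Fin d → heis d} {Z : heis d}
  {P : (Matrix (Fin 2) (Fin 2) ℝ)ˣ}

/-- The subgroup `SL₂(ℝ)` is small-time reachable in `SL₂ ⋉ H_d`, with the controls along the
`X i` equal to zero. -/
theorem inr_mem_smallTimeReachable (h : IsHeisenbergBasis X Y Z)
    (ha : a.1 = P.1 * !![0, 0; 1, 0] * (P⁻¹).1) (hb : b.1 = P.1 * !![0, 1; 0, 0] * (P⁻¹).1)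
    (g : SL2) :
    SemidirectProduct.inr g ∈ smallTimeReachable (tangent d)
      (LieAlgebra.SemiDirectSum.inr (rho d) a) (controls b X Z) hasContinuousLeftMul_coord := by
  have hflow : ∀ (M : ℝ → SL2) (t : ℝ),
      SemidirectProduct.inr (M t) = flow M (1 : HeisenbergGroup d) 0 t := fun M t => by
    simp only [flow, inv_one, zero_mul]
    rw [show act (M t) (1 : HeisenbergGroup d) = 1 from map_one (action d (M t)),
      show (central 0 : HeisenbergGroup d) = 1 from rfl]
    simp
  obtain ⟨g, rfl⟩ := SL2.conj_surjective P g
  refine SL2.map_mem_smallTimeReachable hasContinuousLeftMul_coord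
    (SemidirectProduct.inr.comp (SL2.conj P)) (fun t ht => ?_) (fun ω hω t ht => ?_) g
  · rw [MonoidHom.comp_apply, hflow fun t => SL2.conj P (SL2.lower t)]
    refine flow_mem_reachableSet h (u₀ := 0) (fun s t => by rw [SL2.lower_add, map_mul]) ?_ 1 0
      ?_ ?_ 0 ht
    · rw [zero_smul, add_zero]
      exact SL2.hasDerivAt_conj_lower ha
    · simp [show (0 : heis d).x = 0 from rfl]
    · simp [show (0 : heis d).y = 0 from rfl]
  · rw [MonoidHom.comp_apply, hflow fun t => SL2.conj P (SL2.rot ω hω.ne' t)]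
    refine flow_mem_reachableSet h (u₀ := -ω ^ 2) (fun s t => by rw [SL2.rot_add, map_mul])
      (SL2.hasDerivAt_conj_rot ha hb ω hω.ne') 1 0 ?_ ?_ 0 ht
    · simp [show (0 : heis d).x = 0 from rfl]
    · simp [show (0 : heis d).y = 0 from rfl]

/-- Modulo the center, the exponentials of the span of the `X i` are small-time reachable, with
arbitrary central component. For `A = a - ω² b` the quarter turn `K = A / ω` lies in `SL₂(ℝ)` and
`K² = -1`. Conjugating the flow of `A` by `w = K V / 2` adds a multiple of `V` to the drift; at the
half period, where the flow of `A` is `-1`, its Heisenberg part is `2 w = K V` modulo the center,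
and the factors `±K`, which are small-time reachable, turn it back to `V`. -/
theorem inl_mem_smallTimeReachable_of_span (h : IsHeisenbergBasis X Y Z)
    (ha : a.1 = P.1 * !![0, 0; 1, 0] * (P⁻¹).1) (hb : b.1 = P.1 * !![0, 1; 0, 0] * (P⁻¹).1)
    (μ : Fin d → ℝ) (z : ℝ) :
    SemidirectProduct.inl ⟨(∑ i, μ i • X i).x, (∑ i, μ i • X i).y, z⟩ ∈
      smallTimeReachable (tangent d)
        (LieAlgebra.SemiDirectSum.inr (rho d) a) (controls b X Z) hasContinuousLeftMul_coord := by
  refine mem_smallTimeReachable_of_sandwich hasContinuousLeftMul_coord fun T hT => ?_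
  have hπ := Real.pi_pos
  -- the frequency for which the half period is `T`
  obtain ⟨ω, hω, hωT⟩ : ∃ ω : ℝ, 0 < ω ∧ Real.pi / ω = T :=
    ⟨Real.pi / T, by positivity, by field_simp⟩
  set K := SL2.conj P (SL2.quarter ω hω.ne') with hK
  have hA : (a + (-ω ^ 2) • b).1 = ω • K.1 := by
    rw [SL2.val_add_smul ha hb, hK, SL2.val_conj, ← Matrix.smul_mul, ← Matrix.mul_smul]
    congr 2
    ext i j
    fin_cases i <;> fin_cases j <;> simp [SL2.val_quarter, hω.ne', pow_two]
  have hneg : SL2.conj P (-1) = -1 := by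
    apply Subtype.ext
    rw [SL2.val_conj]
    simp
  have hKK : K * K = -1 := by
    rw [hK, ← map_mul, ← hneg]
    congr 1
    apply SL2.ext_entries <;> simp [SL2.val_quarter, Matrix.mul_apply, hω.ne']
  have eK : K.1 * K.1 = -1 := by
    have := congrArg Subtype.val hKK
    simpa using this
  have eK' := fun i j => congrFun (congrFun eK i) j
  simp only [Matrix.mul_apply, Fin.sum_univ_two] at eK'
  have e00 := eK' 0 0
  have e01 := eK' 0 1
  have e10 := eK' 1 0
  have e11 := eK' 1 1
  simp only [Matrix.neg_apply, Matrix.one_apply_eq, ne_eq, zero_ne_one, one_ne_zero,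
    not_false_eq_true, Matrix.one_apply_ne, neg_zero] at e00 e01 e10 e11
  set V := ∑ i, μ i • X i with hV
  let w : HeisenbergGroup d := ⟨(1 / 2 : ℝ) • (K.1 0 0 • V.x + K.1 0 1 • V.y),
    (1 / 2 : ℝ) • (K.1 1 0 • V.x + K.1 1 1 • V.y), 0⟩
  let M : ℝ → SL2 := fun t => SL2.conj P (SL2.rot ω hω.ne' t)
  have hsum : ∑ i, (ω / 2 * μ i) • X i = (ω / 2) • V := by
    rw [hV, Finset.smul_sum]
    exact Finset.sum_congr rfl fun i _ => mul_smul _ _ _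
  have hflow : ∀ ζ, flow M w ζ T ∈ reachableSet coord (tangent d)
      (LieAlgebra.SemiDirectSum.inr (rho d) a) (controls b X Z) T := by
    intro ζ
    refine flow_mem_reachableSet h (u₀ := -ω ^ 2)
      (fun s t => (congrArg _ (SL2.rot_add ω hω.ne' s t)).trans (map_mul _ _ _))
      (SL2.hasDerivAt_conj_rot ha hb ω hω.ne') w (fun i => ω / 2 * μ i) ?_ ?_ ζ hT.le
    · rw [hsum, hA]
      ext i
      simp [w]
      linear_combination (ω / 2 * V.x i) * e00 + (ω / 2 * V.y i) * e01
    · rw [hsum, hA]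
      ext i
      simp [w]
      linear_combination (ω / 2 * V.x i) * e10 + (ω / 2 * V.y i) * e11
  have hMT : M T = -1 := by
    simp only [M]
    rw [← hωT, SL2.rot_half, hneg]
  let p : HeisenbergGroup d := act (-K) (w * act (-1) w⁻¹)
  have hp : p = ⟨V.x, V.y, p.z⟩ := by
    ext i
    · simp [p, w, act]
      linear_combination (-V.x i) * e00 + (-V.y i) * e01
    · simp [p, w, act]
      linear_combination (-V.x i) * e10 + (-V.y i) * e11
    · rfl
  have hmem := inr_mem_smallTimeReachable h ha hb (-K)
  refine ⟨_, hmem, _, hflow ((z - p.z) / T), _, hmem, ?_⟩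
  have h1 : (⟨V.x, V.y, z⟩ : HeisenbergGroup d) = p * central (z - p.z) := by
    rw [← mk_eq_mul_central, hp]
  have h2 : p * central (z - p.z) =
      act (-K) (w * act (-1) w⁻¹ * central ((z - p.z) / T * T)) := by
    rw [act_mul (-K) _ (central _), act_central, div_mul_cancel₀ _ hT.ne']
  -- the factor `-1 = M T` is absorbed on the right: `(-K)⁻¹ = K = -1 * -K`
  rw [h1, h2, inl_act, flow, hMT, ← mul_assoc, mul_assoc _ (SemidirectProduct.inr (-1)),
    ← map_mul]
  congr 2
  rw [inv_eq_iff_mul_eq_one]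
  rw [neg_one_mul, neg_neg, neg_mul, hKK, neg_neg]

/-- Every element of `H_d` is small-time reachable: the vectors `(x, y)` all of whose multiples
lift to small-time reachable elements form an `SL₂(ℝ)`-invariant subspace that contains the
`X i`. -/
theorem inl_mem_smallTimeReachable (h : IsHeisenbergBasis X Y Z)
    (ha : a.1 = P.1 * !![0, 0; 1, 0] * (P⁻¹).1) (hb : b.1 = P.1 * !![0, 1; 0, 0] * (P⁻¹).1)
    (k : HeisenbergGroup d) :
    SemidirectProduct.inl k ∈ smallTimeReachable (tangent d)
      (LieAlgebra.SemiDirectSum.inr (rho d) a) (controls b X Z) hasContinuousLeftMul_coord := by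
  set S := smallTimeReachable (tangent d) (LieAlgebra.SemiDirectSum.inr (rho d) a)
    (controls b X Z) hasContinuousLeftMul_coord
  have hspan : ∀ (μ : Fin d → ℝ) (z : ℝ),
      SemidirectProduct.inl ⟨(∑ i, μ i • X i).x, (∑ i, μ i • X i).y, z⟩ ∈ S :=
    inl_mem_smallTimeReachable_of_span h ha hb
  let W : Submodule ℝ ((Fin d → ℝ) × (Fin d → ℝ)) :=
    { carrier := {p | ∀ s z : ℝ, SemidirectProduct.inl ⟨s • p.1, s • p.2, z⟩ ∈ S}
      add_mem' := fun {p q} hp hq s z => by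
        have := S.mul_mem (hp s (z - (s • p.1) ⬝ᵥ (s • q.2))) (hq s 0)
        rw [← map_mul] at this
        convert this using 2
        ext <;> simp [mul_add]
      zero_mem' := fun s z => by
        have := hspan 0 z
        simpa [show (0 : heis d).x = 0 from rfl, show (0 : heis d).y = 0 from rfl] using this
      smul_mem' := fun r p hp s z => by
        have := hp (s * r) z
        simpa [mul_smul] using this }
  have hW : W = ⊤ := by
    refine h.submodule_eq_top W (fun i s z => ?_) fun g x y hxy s z => ?_
    · have := hspan (Pi.single i s) z
      simpa [Pi.single_apply, ite_smul] using this
    · have hg := inr_mem_smallTimeReachable h ha hb g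
      have hg' := inr_mem_smallTimeReachable h ha hb g⁻¹
      let q : HeisenbergGroup d := act g ⟨s • x, s • y, 0⟩
      have := S.mul_mem (S.mul_mem hg (hxy s (z - q.z))) hg'
      rw [← inl_act] at this
      convert this using 2
      have h1 : (⟨s • x, s • y, z - q.z⟩ : HeisenbergGroup d) =
          ⟨s • x, s • y, 0⟩ * central (z - q.z) := by
        ext <;> simp [central]
      rw [h1, act_mul, act_central]
      ext i
      · simp [act, central]; ring
      · simp [act, central]; ring
      · simp [central, q]
  have hk : (k.x, k.y) ∈ W := by rw [hW]; trivial
  have := hk 1 k.z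
  simpa using this

theorem isSmallTimeControllable {c : sl2} (habc : IsSl2Basis a b c)
    (h : IsHeisenbergBasis X Y Z) :
    IsSmallTimeControllable coord (tangent d) (LieAlgebra.SemiDirectSum.inr (rho d) a)
      (controls b X Z) := by
  obtain ⟨P, ha, hb⟩ := habc.exists_conj
  intro g
  rw [← SemidirectProduct.inl_left_mul_inr_right g]
  exact mul_mem (inl_mem_smallTimeReachable h ha hb g.left)
    (inr_mem_smallTimeReachable h ha hb g.right)

end JacobiGroup
end

theorem mainTheorem1 (a b c : sl2) (habc : IsSl2Basis a b c) :
    (∀ (d : ℕ) (X Y : Fin d → heis d) (Z : heis d),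
      IsHeisenbergBasis X Y Z →
      ControlAffine.IsSmallTimeControllable (G := JacobiGroup d) JacobiGroup.coord
        (JacobiGroup.tangent d) (LieAlgebra.SemiDirectSum.inr (rho d) a)
        (JacobiGroup.controls b X Z)) ∧
    ControlAffine.IsSmallTimeControllable (G := SL2) SL2.coord SL2.tangent a
      (fun _ : Unit => b) :=
  ⟨fun _ _ _ _ h => JacobiGroup.isSmallTimeControllable habc h, SL2.isSmallTimeControllable habc⟩
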